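/- For $N\ge 1$ let $\mathcal S=\mathbb R^N$, $M[\phi]=\sum_{x=1}^N\phi_x$, $N[\phi]=\sum_{x=1}^N\phi_x^2$, and let $U:\mathbb R^N\to\mathbb R\times\mathbb R^{N-1}$ be any orthogonal map with $(U\phi)_1=N^{-1/2}\sum_x\phi_x$. For $\rho>0$ and $m\in(-\sqrt\rho,\sqrt\rho)$ (and $N\ge 2$) the auxiliary microcanonical ensemble is the probability measure on $\mathbb R^N$ with expectation $$\langle g\rangle_{\mathrm{MC}}^{m,\rho;N}=\frac1{|\mathbb S^{N-2}|}\int_{\mathbb S^{N-2}}d\Omega\;(g\circ U^{-1})\bigl(m\sqrt N,\ \sqrt{N(\rho-m^2)}\,\Omega\bigr),$$ and for $\mu\in\mathbb R$, $\eta>0$ the auxiliary grand canonical ensemble is the probability measure on $\mathbb R^N$ with expectation $$\langle g\rangle_{\mathrm{GC}}^{\mu,\eta;N}=\frac{\int_{\mathbb R^N}e^{-\mu M[\phi]-\eta N[\phi]}g(\phi)\,d\phi}{\int_{\mathbb R^N}e^{-\mu M[\phi]-\eta N[\phi]}\,d\phi}.$$ For $I\subset\{1,\dots,N\}$ with $|I|=n$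 let $P_I:\mathbb R^N\to\mathbb R^n$ be the projection onto the coordinates in $I$, listed in increasing order. Theorem. Let $\rho>0$, $m\in(-\sqrt\rho,\sqrt\rho)$, $\mu:=-\frac{m}{\rho-m^2}$ and $\eta:=\frac1{2(\rho-m^2)}$. Let $n\ge 0$ be fixed and let $f:\mathbb R^n\to\mathbb R$ be either a bounded function which is $1$-Lipschitz with respect to the Euclidean norm $\|\cdot\|_2$, or a moment $f(y)=\prod_{i=1}^n y_i^{k_i}$ with $k_1,\dots,k_n\in\{0,1,2,\dots\}$. Then there are $C$ and $N_0$, which may depend on $\rho,m,n,f$, such that for all $N\ge N_0$, all $U$ as above and all $I\subset\{1,\dots,N\}$ with $|I|=n$, the function $f\circ P_I$ is integrable with respect to both ensembles and $$\Bigl|\langle f\circ P_I\rangle_{\mathrm{MC}}^{m,\rho;N}-\langle f\circ P_I\rangle_{\mathrm{GC}}^{\mu,\eta;N}\Bigr|\le C\,N^{-1/2}.$$ -/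

import Mathlib

open MeasureTheory

noncomputable section

namespace SphericalModel

/-- The space of field configurations `ℝ^Λ` on the lattice `Λ = [N]`, with the Euclidean norm and
Lebesgue measure. -/
abbrev Config (N : ℕ) : Type := EuclideanSpace ℝ (Fin N)

/-- The magnetization `M[φ] = ∑ₓ φ(x)`. -/
def magnetization {N : ℕ} (φ : Config N) : ℝ := ∑ x, φ x

/-- The particle number `N[φ] = ∑ₓ φ(x)²`. -/
def particleNumber {N : ℕ} (φ : Config N) : ℝ := ∑ x, φ x ^ 2

/-- The range `ℝ × ℝ^{N-1}` of the orthogonal change of variables, with its Euclidean norm. -/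
abbrev Split (N : ℕ) : Type := WithLp 2 (ℝ × EuclideanSpace ℝ (Fin (N - 1)))

/-- The orthogonal map `U : ℝ^N → ℝ × ℝ^{N-1}` has first coordinate
`(U φ)₁ = N^{-1/2} ∑ₓ φ(x)`. (Being orthogonal, it then diagonalizes the all-ones matrix.) -/
def IsMagnetizationFrame {N : ℕ} (U : Config N ≃ₗᵢ[ℝ] Split N) : Prop :=
  ∀ φ : Config N, (U φ).fst = 1 / √(N : ℝ) * ∑ x, φ x

/-- Such an orthogonal map exists as soon as the lattice is non-empty. -/
theorem exists_isMagnetizationFrame {N : ℕ} (hN : 1 ≤ N) :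
    ∃ U : Config N ≃ₗᵢ[ℝ] Split N, IsMagnetizationFrame U := by
  classical
  have hN0 : (0 : ℝ) < N := by exact_mod_cast hN
  let v : Config N := WithLp.toLp 2 (fun _ => 1 / √(N : ℝ))
  have hv : ‖v‖ = 1 := by
    rw [EuclideanSpace.norm_eq, Real.sqrt_eq_one]
    simp [v, Real.sq_sqrt hN0.le, hN0.ne']
  let w : Unit ⊕ Fin (N - 1) → Config N := fun _ => v
  have hw : Orthonormal ℝ (({Sum.inl ()} : Set (Unit ⊕ Fin (N - 1))).domRestrict w) := by
    rw [orthonormal_iff_ite]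
    rintro ⟨i, hi⟩ ⟨j, hj⟩
    obtain rfl : i = Sum.inl () := hi
    obtain rfl : j = Sum.inl () := hj
    simp [w, Set.domRestrict, hv]
  have hc : Module.finrank ℝ (Config N) = Fintype.card (Unit ⊕ Fin (N - 1)) := by
    simp; omega
  obtain ⟨b, hb⟩ := hw.exists_orthonormalBasis_extension_of_card_eq hc
  let b' : OrthonormalBasis (Unit ⊕ Fin (N - 1)) ℝ (Split N) :=
    (OrthonormalBasis.singleton Unit ℝ).prod (EuclideanSpace.basisFun (Fin (N - 1)) ℝ)
  refine ⟨b.equiv b' (Equiv.refl _), fun φ => ?_⟩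
  have h1 : b (Sum.inl ()) = v := hb _ rfl
  have h2 : b.equiv b' (Equiv.refl _) v = b' (Sum.inl ()) := by
    rw [← h1, OrthonormalBasis.equiv_apply_basis]; rfl
  have h3 := (b.equiv b' (Equiv.refl _)).inner_map_map v φ
  rw [h2] at h3
  simp [b', v, WithLp.prod_inner_apply, PiLp.inner_apply] at h3
  rw [h3, Finset.mul_sum]
  exact Finset.sum_congr rfl fun x _ => by ring

/-- The auxiliary microcanonical ensemble with magnetization density `m` and particle density `ρ`:
the law of `U⁻¹ (m √N, √(N (ρ - m²)) Ω)` for `Ω` uniformly distributed (with respect to the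
normalized surface measure) on the unit sphere `𝕊^{N-2}` of `ℝ^{N-1}`. -/
def microcanonical {N : ℕ} (U : Config N ≃ₗᵢ[ℝ] Split N) (m ρ : ℝ) : Measure (Config N) :=
  let σ : Measure (Metric.sphere (0 : EuclideanSpace ℝ (Fin (N - 1))) 1) :=
    (volume : Measure (EuclideanSpace ℝ (Fin (N - 1)))).toSphere
  ((σ Set.univ)⁻¹ • σ).map fun (Ω : Metric.sphere (0 : EuclideanSpace ℝ (Fin (N - 1))) 1) =>
    U.symm (WithLp.toLp 2
      (m * √(N : ℝ), √((N : ℝ) * (ρ - m ^ 2)) • (Ω : EuclideanSpace ℝ (Fin (N - 1)))))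

/-- The auxiliary grand canonical ensemble with magnetic potential `μ` and chemical potential `η`:
Lebesgue measure with density `exp (-μ M[φ] - η N[φ])`, normalized by the integral of this
function. -/
def grandCanonical (N : ℕ) (μ η : ℝ) : Measure (Config N) :=
  (volume : Measure (Config N)).tilted fun φ => -μ * magnetization φ - η * particleNumber φ

/-- The projection `P_I : ℝ^N → ℝ^n`, `n = |I|`, onto the coordinates in `I ⊆ [N]`, listed in
increasing order. -/
def proj {N n : ℕ} (I : Finset (Fin N)) (hI : I.card = n) (φ : Config N) :
    EuclideanSpace ℝ (Fin n) :=
  WithLp.toLp 2 fun j => φ (I.orderEmbOfFin hI j)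

/-- Bounded observables that are `1`-Lipschitz for the Euclidean norm. -/
def IsBoundedLipschitz {n : ℕ} (f : EuclideanSpace ℝ (Fin n) → ℝ) : Prop :=
  (∃ B : ℝ, ∀ y, |f y| ≤ B) ∧ LipschitzWith 1 f

/-- Moment observables: finite products `y₁^{k₁} ⋯ yₙ^{kₙ}` of finite powers of the coordinates. -/
def IsMoment {n : ℕ} (f : EuclideanSpace ℝ (Fin n) → ℝ) : Prop :=
  ∃ k : Fin n → ℕ, ∀ y, f y = ∏ i, y i ^ k i

end SphericalModel

end

/-! The two ensembles are coupled. Put `v = ρ - m²`. Completing the square shows that the grand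
canonical ensemble is Gaussian, with mean `m` at every site and covariance `v` times the identity.
By rotation invariance it is the law of `m·1 + √v U⁻¹(z, rΩ)`, where `z` is a standard normal
variable, `Ω` is uniform on the sphere, `r` is the norm of a standard Gaussian in `ℝ^(N-1)`, and all
three are independent. The microcanonical field with the same `Ω` is `m·1 + √v U⁻¹(0, √N Ω)`.

At a site `x` the fields differ, up to sign, by `√v (z/√N + (r - √N)⟨w, Ω⟩)`, where `w` is the
second component of `U eₓ` and `‖w‖ ≤ 1`. The radius fluctuates by `O(1)` in `L²`, while `⟨w, Ω⟩` is
`O(N^(-1/2))` and independent of it, so the difference is `O(N^(-1/2))` in `L²` (`exists_coupling`).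

Both kinds of observable have polynomially growing difference quotients. Hölder's inequality and
uniform moment bounds carry the rate over to expectations (`abs_integral_comp_sub_le`). -/

/-! ### Gaussian form of the grand canonical ensemble. -/

-- Characteristic functions agree: translation by `a` contributes a phase, and the rest is the
-- Fourier transform of a centred Gaussian.
open ProbabilityTheory in
theorem tilted_neg_sq_norm_sub_eq_map_stdGaussian {E : Type*} [NormedAddCommGroup E]
    [InnerProductSpace ℝ E] [FiniteDimensional ℝ E] [MeasurableSpace E] [BorelSpace E]
    (a : E) {v : ℝ} (hv : 0 < v) :
    (volume : Measure E).tilted (fun x => -(2 * v)⁻¹ * ‖x - a‖ ^ 2) =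
      (stdGaussian E).map (fun x => a + √v • x) := by
  have hb : 0 < (2 * v)⁻¹ := by positivity
  have hbc : 0 < (((2 * v)⁻¹ : ℝ) : ℂ).re := by simpa using hb
  have hZ : ∫ x : E, Real.exp (-(2 * v)⁻¹ * ‖x - a‖ ^ 2) =
      ∫ x : E, Real.exp (-(2 * v)⁻¹ * ‖x‖ ^ 2) :=
    integral_sub_right_eq_self (fun x : E => Real.exp (-(2 * v)⁻¹ * ‖x‖ ^ 2)) a
  have hZpos : (0 : ℝ) < ∫ x : E, Real.exp (-(2 * v)⁻¹ * ‖x‖ ^ 2) := by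
    rw [GaussianFourier.integral_rexp_neg_mul_sq_norm hb]; positivity
  have hZc : ((∫ x : E, Real.exp (-(2 * v)⁻¹ * ‖x‖ ^ 2) : ℝ) : ℂ) =
      (Real.pi / ((2 * v)⁻¹ : ℝ) : ℂ) ^ (Module.finrank ℝ E / 2 : ℂ) := by
    rw [← GaussianFourier.integral_cexp_neg_mul_sq_norm hbc, ← integral_complex_ofReal]
    congr 1 with x
    push_cast; rfl
  have hint : Integrable (fun x : E => Real.exp (-(2 * v)⁻¹ * ‖x - a‖ ^ 2)) :=
    .of_integral_ne_zero (by rw [hZ]; exact hZpos.ne')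
  have := isProbabilityMeasure_tilted hint
  have : IsProbabilityMeasure ((stdGaussian E).map (fun x => a + √v • x)) :=
    Measure.isProbabilityMeasure_map (by fun_prop)
  apply Measure.ext_of_charFun
  ext t
  have h1 : (fun x : E => a + √v • x) = (a + ·) ∘ (√v • ·) := rfl
  rw [h1, ← Measure.map_map (by fun_prop) (by fun_prop), charFun_map_const_add, charFun_map_smul,
    charFun_stdGaussian, charFun_apply, integral_tilted, hZ]
  have h2 := integral_sub_right_eq_self (μ := (volume : Measure E))
    (fun x : E => (Real.exp (-(2 * v)⁻¹ * ‖x‖ ^ 2) / ∫ x : E, Real.exp (-(2 * v)⁻¹ * ‖x‖ ^ 2)) •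
      Complex.exp (inner ℝ (x + a) t * Complex.I)) a
  simp only [sub_add_cancel] at h2
  rw [h2]
  have h3 : ∀ x : E, (Real.exp (-(2 * v)⁻¹ * ‖x‖ ^ 2) /
      ∫ x : E, Real.exp (-(2 * v)⁻¹ * ‖x‖ ^ 2)) •
      Complex.exp (inner ℝ (x + a) t * Complex.I) =
      (((∫ x : E, Real.exp (-(2 * v)⁻¹ * ‖x‖ ^ 2) : ℝ) : ℂ)⁻¹ *
        Complex.exp (inner ℝ a t * Complex.I)) *
      Complex.exp (-((2 * v)⁻¹ : ℝ) * ‖x‖ ^ 2 + Complex.I * inner ℝ t x) := by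
    intro x
    rw [Complex.real_smul, inner_add_left, Complex.exp_add, real_inner_comm t x]
    push_cast
    rw [add_mul, Complex.exp_add]
    ring_nf
  simp_rw [h3]
  rw [integral_const_mul, GaussianFourier.integral_cexp_neg_mul_sq_norm_add hbc, ← hZc]
  have hZ0 : ((∫ x : E, Real.exp (-(2 * v)⁻¹ * ‖x‖ ^ 2) : ℝ) : ℂ) ≠ 0 :=
    Complex.ofReal_ne_zero.2 hZpos.ne'
  have h4 : Complex.I ^ 2 * (‖t‖ : ℂ) ^ 2 / (4 * (((2 * v)⁻¹ : ℝ) : ℂ)) =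
      -(‖√v • t‖ : ℂ) ^ 2 / 2 := by
    have hv0 : (v : ℂ) ≠ 0 := Complex.ofReal_ne_zero.2 hv.ne'
    rw [← Complex.ofReal_pow ‖√v • t‖, norm_smul, mul_pow, Real.norm_eq_abs, sq_abs,
      Real.sq_sqrt hv.le, Complex.I_sq]
    push_cast
    field_simp
    norm_num
  rw [h4]
  generalize ((∫ x : E, Real.exp (-(2 * v)⁻¹ * ‖x‖ ^ 2) : ℝ) : ℂ) = Z at hZ0 ⊢
  field_simp

open ProbabilityTheory in
theorem stdGaussian_eq_tilted (E : Type*) [NormedAddCommGroup E]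
    [InnerProductSpace ℝ E] [FiniteDimensional ℝ E] [MeasurableSpace E] [BorelSpace E] :
    stdGaussian E = (volume : Measure E).tilted (fun x => -(2 * 1)⁻¹ * ‖x‖ ^ 2) := by
  simpa using (tilted_neg_sq_norm_sub_eq_map_stdGaussian (0 : E) one_pos).symm

theorem tilted_add_const {α : Type*} {mα : MeasurableSpace α} (μ : Measure α) (f : α → ℝ) (c : ℝ) :
    μ.tilted (fun x => f x + c) = μ.tilted f := by
  simp only [Measure.tilted, Real.exp_add, integral_mul_const]
  congr 2 with x
  rw [mul_div_mul_right _ _ (Real.exp_pos c).ne']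

namespace SphericalModel

open ProbabilityTheory in
theorem grandCanonical_eq_map_stdGaussian (N : ℕ) (m : ℝ) {v : ℝ} (hv : 0 < v) :
    grandCanonical N (-(m / v)) (1 / (2 * v)) =
      (stdGaussian (Config N)).map (fun x => WithLp.toLp 2 (fun _ => m) + √v • x) := by
  -- Completing the square leaves the constant `-N m² / (2v)`, which the normalization absorbs.
  rw [← tilted_neg_sq_norm_sub_eq_map_stdGaussian _ hv, grandCanonical,
    ← tilted_add_const _ _ (-(2 * v)⁻¹ * (N * m ^ 2))]
  congr 1 with φ
  simp only [magnetization, particleNumber, EuclideanSpace.real_norm_sq_eq, PiLp.sub_apply,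
    sub_sq, Finset.sum_add_distrib, Finset.sum_sub_distrib, Finset.sum_const, Finset.card_univ,
    Fintype.card_fin, nsmul_eq_mul, ← Finset.sum_mul, ← Finset.mul_sum]
  field_simp
  ring

/-! ### Polar decomposition of the standard Gaussian. -/

/-- The normalized surface measure on the unit sphere. -/
noncomputable def sphereUniform (E : Type*) [NormedAddCommGroup E] [InnerProductSpace ℝ E]
    [FiniteDimensional ℝ E] [MeasurableSpace E] [BorelSpace E] :
    Measure (Metric.sphere (0 : E) 1) :=
  ((volume : Measure E).toSphere Set.univ)⁻¹ • (volume : Measure E).toSphere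

open ProbabilityTheory Set in
/-- Under the standard Gaussian measure the direction is uniformly distributed and independent of
the norm. -/
theorem exists_stdGaussian_eq_map_sphereUniform_prod (E : Type*) [NormedAddCommGroup E]
    [InnerProductSpace ℝ E] [FiniteDimensional ℝ E] [MeasurableSpace E] [BorelSpace E]
    [Nontrivial E] :
    IsProbabilityMeasure (sphereUniform E) ∧
    ∃ τ : Measure (Ioi (0 : ℝ)), IsProbabilityMeasure τ ∧
      stdGaussian E = ((sphereUniform E).prod τ).map
        (fun p : Metric.sphere (0 : E) 1 × Ioi (0 : ℝ) => (p.2 : ℝ) • (p.1 : E)) := by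
  set σ := (volume : Measure E).toSphere with hσ
  have hσ0 : σ univ ≠ 0 :=
    Measure.measure_univ_ne_zero.2 (Measure.toSphere_ne_zero _)
  have hσt : σ univ ≠ ⊤ := measure_ne_top _ _
  have hprob : IsProbabilityMeasure (sphereUniform E) :=
    ⟨by simp [sphereUniform, ENNReal.inv_mul_cancel hσ0 hσt, ← hσ]⟩
  refine ⟨hprob, ?_⟩
  set Z := ∫ x : E, Real.exp (-(2 * 1)⁻¹ * ‖x‖ ^ 2)
  set h : ℝ → ENNReal := fun r => ENNReal.ofReal (Real.exp (-(2 * 1)⁻¹ * r ^ 2) / Z)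
  have hh : Measurable h := by fun_prop
  -- The radial law up to normalization: its total mass is the inverse of that of `σ`, as testing
  -- `hκ` with `g = 1` shows.
  set κ := (Measure.volumeIoiPow (Module.finrank ℝ E - 1)).withDensity (fun r => h r)
  have hF : Measurable fun p : Metric.sphere (0 : E) 1 × Ioi (0 : ℝ) => (p.2 : ℝ) • (p.1 : E) := by
    fun_prop
  have hκ : ∀ g : E → ENNReal, Measurable g → ∫⁻ x, g x ∂stdGaussian E =
      ∫⁻ p : Metric.sphere (0 : E) 1 × Ioi (0 : ℝ), g ((p.2 : ℝ) • (p.1 : E)) ∂(σ.prod κ) := by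
    intro g hg
    have e1 : ∫⁻ x, g x ∂stdGaussian E = ∫⁻ x : E, h ‖x‖ * g x := by
      rw [stdGaussian_eq_tilted, lintegral_tilted]
    -- The origin is a null set, so polar coordinates apply on its complement.
    have e2 : ∫⁻ x : E, h ‖x‖ * g x = ∫⁻ x : ({0}ᶜ : Set E), h ‖(x : E)‖ * g x
        ∂((volume : Measure E).comap (↑)) := by
      rw [lintegral_subtype_comap (measurableSet_singleton _).compl (fun x => h ‖x‖ * g x),
        restrict_compl_singleton]
    have e3 := (volume : Measure E).measurePreserving_homeomorphUnitSphereProd.lintegral_comp_emb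
      (Homeomorph.measurableEmbedding _)
      (fun p : Metric.sphere (0 : E) 1 × Ioi (0 : ℝ) => h p.2 * g ((p.2 : ℝ) • (p.1 : E)))
    rw [e1, e2]
    have e4 : σ.prod κ = (σ.prod (Measure.volumeIoiPow (Module.finrank ℝ E - 1))).withDensity
        (fun p => h p.2) := by
      rw [prod_withDensity_right (by fun_prop)]
    rw [e4, lintegral_withDensity_eq_lintegral_mul _ (by fun_prop) (by fun_prop)]
    simp only [Pi.mul_apply]
    rw [← e3]
    refine lintegral_congr fun x => ?_
    have hx : ‖(x : E)‖ ≠ 0 := norm_ne_zero_iff.2 x.2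
    simp [smul_smul, hx]
  have hmul : σ univ * κ univ = 1 := by
    have := hκ (fun _ => 1) measurable_const
    rw [← Measure.prod_prod, univ_prod_univ]
    simpa using this.symm
  refine ⟨σ univ • κ, ⟨by simpa using hmul⟩, ?_⟩
  have hprod : (sphereUniform E).prod (σ univ • κ) = σ.prod κ := by
    rw [sphereUniform, Measure.prod_smul_right, Measure.prod_smul_left, smul_smul,
      ENNReal.mul_inv_cancel hσ0 hσt, one_smul]
  rw [hprod]
  ext s hs
  have := hκ (s.indicator 1) (measurable_one.indicator hs)
  rw [lintegral_indicator_one hs] at this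
  rw [this, Measure.map_apply hF hs, ← lintegral_indicator_one (hF hs)]
  rfl

end SphericalModel

/-! ### Gaussian moments and concentration of the norm. -/

theorem eLpNorm_two_eq_ofReal_sqrt {α : Type*} {mα : MeasurableSpace α} {μ : Measure α}
    {f : α → ℝ} (hf : Integrable (fun x => f x ^ 2) μ) :
    eLpNorm f 2 μ = ENNReal.ofReal √(∫ x, f x ^ 2 ∂μ) := by
  rw [eLpNorm_eq_lintegral_rpow_enorm_toReal (by simp) (by simp), Real.sqrt_eq_rpow,
    ← ENNReal.ofReal_rpow_of_nonneg (integral_nonneg fun x => sq_nonneg _) (by norm_num),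
    ofReal_integral_eq_lintegral_ofReal hf (.of_forall fun x => sq_nonneg _)]
  congr 2
  · ext x
    rw [← Real.enorm_of_nonneg (sq_nonneg (f x)), enorm_pow]
    simp

namespace SphericalModel

open ProbabilityTheory

theorem map_inner_stdGaussian {E : Type*} [NormedAddCommGroup E]
    [InnerProductSpace ℝ E] [FiniteDimensional ℝ E] [MeasurableSpace E] [BorelSpace E] (w : E) :
    (stdGaussian E).map (fun x => inner ℝ w x) = (gaussianReal 0 1).map (‖w‖ * ·) := by
  have h := IsGaussian.map_eq_gaussianReal (μ := stdGaussian E) (innerSL ℝ w)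
  rw [integral_strongDual_stdGaussian, variance_dual_stdGaussian] at h
  rw [gaussianReal_map_const_mul]
  convert! h using 2
  · simp
  · ext; simp

theorem eLpNorm_inner_stdGaussian {E : Type*} [NormedAddCommGroup E]
    [InnerProductSpace ℝ E] [FiniteDimensional ℝ E] [MeasurableSpace E] [BorelSpace E] (w : E)
    (p : ENNReal) :
    eLpNorm (fun x => inner ℝ w x) p (stdGaussian E) =
      ‖w‖ₑ * eLpNorm id p (gaussianReal 0 1) := by
  have h := eLpNorm_map_measure (p := p) (g := (id : ℝ → ℝ)) (μ := stdGaussian E)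
    (f := fun x => inner ℝ w x) (by fun_prop) (by fun_prop)
  rw [map_inner_stdGaussian, eLpNorm_map_measure (by fun_prop) (by fun_prop)] at h
  change _ = eLpNorm (fun x => inner ℝ w x) p (stdGaussian E) at h
  rw [← h]
  have := eLpNorm_const_smul (‖w‖) (id : ℝ → ℝ) p (gaussianReal 0 1)
  rw [enorm_norm] at this
  rw [← this]
  rfl

theorem integral_sq_gaussianReal : ∫ x, x ^ 2 ∂gaussianReal 0 1 = 1 := by
  have := variance_id_gaussianReal (μ := 0) (v := 1)
  rw [variance_of_integral_eq_zero (by fun_prop) (by simp)] at this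
  simpa using this

theorem memLp_sq_gaussianReal : MemLp (fun x : ℝ => x ^ 2) 2 (gaussianReal 0 1) := by
  have h := memLp_id_gaussianReal' (μ := 0) (v := 1) 4 (by simp)
  rw [memLp_two_iff_integrable_sq (by fun_prop)]
  have := h.integrable_norm_pow (by simp)
  simpa [← pow_mul, Even.pow_abs (n := 4) (by decide)] using this

theorem memLp_normSq_stdGaussian (d : ℕ) :
    MemLp (fun x => ‖x‖ ^ 2) 2 (stdGaussian (EuclideanSpace ℝ (Fin d))) := by
  rw [← map_pi_eq_stdGaussian, memLp_map_measure_iff (by fun_prop) (by fun_prop)]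
  have : (fun x : EuclideanSpace ℝ (Fin d) => ‖x‖ ^ 2) ∘ WithLp.toLp 2 =
      fun x : Fin d → ℝ => ∑ i, x i ^ 2 := by
    ext x; simp [EuclideanSpace.real_norm_sq_eq]
  rw [this]
  exact memLp_finsetSum _ fun i _ =>
    memLp_sq_gaussianReal.comp_measurePreserving (measurePreserving_eval _ i)

theorem integral_normSq_stdGaussian (d : ℕ) :
    ∫ x, ‖x‖ ^ 2 ∂stdGaussian (EuclideanSpace ℝ (Fin d)) = d := by
  rw [← map_pi_eq_stdGaussian, integral_map (by fun_prop) (by fun_prop)]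
  simp only [EuclideanSpace.real_norm_sq_eq]
  rw [integral_finsetSum]
  · have : ∀ i : Fin d, ∫ x : Fin d → ℝ, x i ^ 2 ∂Measure.pi (fun _ => gaussianReal 0 1) = 1 := by
      intro i
      rw [← integral_sq_gaussianReal]
      exact integral_comp_eval (μ := fun _ : Fin d => gaussianReal 0 1) (f := fun x : ℝ => x ^ 2)
        (by fun_prop)
    simp [this]
  · intro i _
    exact (memLp_sq_gaussianReal.comp_measurePreserving
      (measurePreserving_eval (fun _ : Fin d => gaussianReal 0 1) i)).integrable (by simp)

theorem variance_normSq_stdGaussian (d : ℕ) :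
    Var[fun x => ‖x‖ ^ 2; stdGaussian (EuclideanSpace ℝ (Fin d))] =
      d * Var[fun x => x ^ 2; gaussianReal 0 1] := by
  rw [← map_pi_eq_stdGaussian, variance_map (by fun_prop) (by fun_prop)]
  have : (fun x : EuclideanSpace ℝ (Fin d) => ‖x‖ ^ 2) ∘ WithLp.toLp 2 =
      ∑ i, fun x : Fin d → ℝ => x i ^ 2 := by
    ext x; simp [EuclideanSpace.real_norm_sq_eq]
  rw [this, variance_sum_pi (X := fun (_ : Fin d) (x : ℝ) => x ^ 2)
    (fun _ => memLp_sq_gaussianReal)]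
  simp

theorem eLpNorm_norm_stdGaussian (d : ℕ) :
    eLpNorm (fun x => ‖x‖) 2 (stdGaussian (EuclideanSpace ℝ (Fin d))) = ENNReal.ofReal √d := by
  rw [eLpNorm_two_eq_ofReal_sqrt ((memLp_normSq_stdGaussian d).integrable (by simp)),
    integral_normSq_stdGaussian]

/-- The norm of a standard Gaussian vector concentrates around the square root of the dimension. -/
theorem eLpNorm_norm_sub_sqrt_stdGaussian_le (d : ℕ) :
    eLpNorm (fun x => ‖x‖ - √((d : ℝ) + 1)) 2 (stdGaussian (EuclideanSpace ℝ (Fin d))) ≤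
      ENNReal.ofReal (√(Var[fun x => x ^ 2; gaussianReal 0 1]) + 1) := by
  set γ := stdGaussian (EuclideanSpace ℝ (Fin d))
  set K := Var[fun x => x ^ 2; gaussianReal 0 1]
  have hK : 0 ≤ K := variance_nonneg _ _
  have hd : (0 : ℝ) < √((d : ℝ) + 1) := by positivity
  have h1 : eLpNorm (fun x => ‖x‖ ^ 2 - (d : ℝ)) 2 γ = ENNReal.ofReal √(d * K) := by
    rw [eLpNorm_two_eq_ofReal_sqrt, ← variance_normSq_stdGaussian, variance_eq_integral (by fun_prop),
      integral_normSq_stdGaussian]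
    exact ((memLp_normSq_stdGaussian d).sub (memLp_const _)).integrable_sq
  -- The centre is `d + 1` because `d = N - 1` later on; moving it from the mean `d` costs the
  -- summand `1`.
  have h2 : eLpNorm (fun x => ‖x‖ ^ 2 - ((d : ℝ) + 1)) 2 γ ≤ ENNReal.ofReal (√(d * K) + 1) := by
    have e : (fun x : EuclideanSpace ℝ (Fin d) => ‖x‖ ^ 2 - ((d : ℝ) + 1)) =
        (fun x => ‖x‖ ^ 2 - (d : ℝ)) - fun _ => (1 : ℝ) := by ext x; simp; ring
    rw [e]
    refine (eLpNorm_sub_le (by fun_prop) (by fun_prop) (by simp)).trans ?_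
    rw [h1, ENNReal.ofReal_add (by positivity) (by positivity),
      eLpNorm_const _ (by simp) (NeZero.ne _)]
    simp
  calc
    _ ≤ ENNReal.ofReal (√((d : ℝ) + 1))⁻¹ * eLpNorm (fun x => ‖x‖ ^ 2 - ((d : ℝ) + 1)) 2 γ := by
      refine eLpNorm_le_mul_eLpNorm_of_ae_le_mul (.of_forall fun x => ?_) 2
      -- Dividing by `‖x‖ + √(d+1) ≥ √(d+1)` cancels the `√d` growth of the deviation of `‖x‖²`.
      have : ‖x‖ ^ 2 - ((d : ℝ) + 1) = (‖x‖ - √((d : ℝ) + 1)) * (‖x‖ + √((d : ℝ) + 1)) := by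
        nlinarith [Real.sq_sqrt (show (0 : ℝ) ≤ (d : ℝ) + 1 by positivity)]
      rw [this, norm_mul, Real.norm_eq_abs (‖x‖ + _), abs_of_pos (by positivity), le_inv_mul_iff₀ hd,
        mul_comm]
      gcongr
      linarith [norm_nonneg x]
    _ ≤ ENNReal.ofReal (√((d : ℝ) + 1))⁻¹ * ENNReal.ofReal (√(d * K) + 1) := by gcongr
    _ ≤ _ := by
      rw [← ENNReal.ofReal_mul (by positivity)]
      refine ENNReal.ofReal_le_ofReal ?_
      rw [inv_mul_le_iff₀ hd, mul_add, mul_one, ← Real.sqrt_mul (by positivity)]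
      have : 1 ≤ √((d : ℝ) + 1) := by rw [Real.one_le_sqrt]; simp
      gcongr
      linarith

end SphericalModel

/-! ### Coordinates of the orthogonal frame and moments of the direction. -/

theorem eLpNorm_mul_prod {α β : Type*} {mα : MeasurableSpace α} {mβ : MeasurableSpace β}
    {μ : Measure α} {ν : Measure β} [SFinite μ] [SFinite ν] {f : α → ℝ} {g : β → ℝ}
    (hf : Measurable f) (hg : Measurable g) {p : ENNReal} (hp0 : p ≠ 0) (hp : p ≠ ⊤) :
    eLpNorm (fun q : α × β => g q.2 * f q.1) p (μ.prod ν) = eLpNorm g p ν * eLpNorm f p μ := by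
  simp only [eLpNorm_eq_lintegral_rpow_enorm_toReal hp0 hp, enorm_mul]
  rw [← ENNReal.mul_rpow_of_nonneg _ _ (by positivity), mul_comm (lintegral _ _),
    ← lintegral_prod_mul (by fun_prop) (by fun_prop)]
  congr 2 with q
  rw [ENNReal.mul_rpow_of_nonneg _ _ (by positivity), mul_comm]

namespace SphericalModel

open ProbabilityTheory Set

section Frame

variable {N : ℕ} {U : Config N ≃ₗᵢ[ℝ] Split N}

/-- A coordinate is the inner product with a basis vector, which the isometry `U` carries to the
split space. -/
theorem IsMagnetizationFrame.symm_apply (hU : IsMagnetizationFrame U) (a : ℝ)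
    (z : EuclideanSpace ℝ (Fin (N - 1))) (x : Fin N) :
    U.symm (WithLp.toLp 2 (a, z)) x =
      1 / √(N : ℝ) * a + inner ℝ (U (EuclideanSpace.single x 1)).snd z := by
  have h1 : U.symm (WithLp.toLp 2 (a, z)) x =
      inner ℝ (EuclideanSpace.single x (1 : ℝ)) (U.symm (WithLp.toLp 2 (a, z))) := by
    simp [EuclideanSpace.inner_single_left]
  have h2 : (U (EuclideanSpace.single x 1)).fst = 1 / √(N : ℝ) := by
    rw [hU]; simp
  rw [h1, ← U.inner_map_map, U.apply_symm_apply, WithLp.prod_inner_apply, ← h2]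
  congr 1
  exact mul_comm _ _

theorem norm_snd_apply_single_le (U : Config N ≃ₗᵢ[ℝ] Split N) (x : Fin N) :
    ‖(U (EuclideanSpace.single x 1)).snd‖ ≤ 1 := by
  have h := WithLp.prod_norm_sq_eq_of_L2 (U (EuclideanSpace.single x 1))
  rw [U.norm_map] at h
  simp only [PiLp.norm_single, norm_one, one_pow] at h
  exact abs_le_one_iff_mul_self_le_one.2 (by nlinarith [sq_nonneg ‖(U (EuclideanSpace.single x 1)).fst‖])
    |>.trans' (le_abs_self _)

end Frame

section Radial

variable {d : ℕ} {τ : Measure (Ioi (0 : ℝ))} [IsProbabilityMeasure τ]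
  [IsProbabilityMeasure (sphereUniform (EuclideanSpace ℝ (Fin d)))]

theorem eLpNorm_comp_norm_of_polar
    (h : stdGaussian (EuclideanSpace ℝ (Fin d)) =
      ((sphereUniform (EuclideanSpace ℝ (Fin d))).prod τ).map
        fun p => (p.2 : ℝ) • (p.1 : EuclideanSpace ℝ (Fin d)))
    {g : ℝ → ℝ} (hg : Measurable g) (p : ENNReal) :
    eLpNorm (fun x => g ‖x‖) p (stdGaussian (EuclideanSpace ℝ (Fin d))) =
      eLpNorm (fun r : Ioi (0 : ℝ) => g r) p τ := by
  rw [h, eLpNorm_map_measure (by exact (hg.comp measurable_norm).aestronglyMeasurable)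
      (by fun_prop),
    ← eLpNorm_comp_measurePreserving (g := fun r : Ioi (0 : ℝ) => g r)
      (hg.comp measurable_subtype_coe).aestronglyMeasurable
      (measurePreserving_snd (μ := sphereUniform (EuclideanSpace ℝ (Fin d))))]
  congr 1 with q
  simp [norm_smul, abs_of_pos (Set.mem_Ioi.1 q.2.2)]

/-- For a Gaussian `G = rΩ`, independence gives `‖r‖_p ‖⟨w,Ω⟩‖_p = ‖⟨w,G⟩‖_p`, which is at most the
`p`-norm of a standard normal variable. Since `p ≥ 2`, also `‖r‖_p ≥ ‖r‖_2 = √d`. -/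
theorem eLpNorm_inner_sphereUniform_le
    (h : stdGaussian (EuclideanSpace ℝ (Fin d)) =
      ((sphereUniform (EuclideanSpace ℝ (Fin d))).prod τ).map
        fun p => (p.2 : ℝ) • (p.1 : EuclideanSpace ℝ (Fin d)))
    {w : EuclideanSpace ℝ (Fin d)} (hw : ‖w‖ ≤ 1) (hd : 1 ≤ d) {p : ENNReal} (hp2 : 2 ≤ p)
    (hp : p ≠ ⊤) :
    eLpNorm (fun Ω : Metric.sphere (0 : EuclideanSpace ℝ (Fin d)) 1 => inner ℝ w (Ω : _)) p
        (sphereUniform (EuclideanSpace ℝ (Fin d))) ≤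
      ENNReal.ofReal (2 / √((d : ℝ) + 1)) * eLpNorm id p (gaussianReal 0 1) := by
  have hd' : (1 : ℝ) ≤ d := by exact_mod_cast hd
  have h1 := eLpNorm_inner_stdGaussian w p
  rw [h, eLpNorm_map_measure (by fun_prop) (by fun_prop)] at h1
  have h2 := eLpNorm_mul_prod (p := p) (μ := sphereUniform (EuclideanSpace ℝ (Fin d))) (ν := τ)
    (f := fun Ω : Metric.sphere (0 : EuclideanSpace ℝ (Fin d)) 1 => inner ℝ w (Ω : _))
    (g := fun r => (r : ℝ)) (by fun_prop) (by fun_prop) (by rintro rfl; simp at hp2) hp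
  have h3 : ENNReal.ofReal √d ≤ eLpNorm (fun r : Ioi (0 : ℝ) => (r : ℝ)) p τ := by
    rw [← eLpNorm_norm_stdGaussian, eLpNorm_comp_norm_of_polar h (g := fun r => r) measurable_id]
    exact eLpNorm_le_eLpNorm_of_exponent_le hp2 (by fun_prop)
  set a := eLpNorm (fun Ω : Metric.sphere (0 : EuclideanSpace ℝ (Fin d)) 1 => inner ℝ w (Ω : _)) p
    (sphereUniform (EuclideanSpace ℝ (Fin d)))
  have h4 : ENNReal.ofReal √d * a ≤ eLpNorm id p (gaussianReal 0 1) := by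
    calc _ ≤ _ := mul_le_mul_left h3 a
      _ = ‖w‖ₑ * eLpNorm id p (gaussianReal 0 1) := by
        rw [← h2, ← h1]; congr 1 with q; simp [inner_smul_right]
      _ ≤ 1 * eLpNorm id p (gaussianReal 0 1) := by
        gcongr
        rw [← ofReal_norm, ENNReal.ofReal_le_one]
        exact hw
      _ = _ := one_mul _
  -- The factor `2` covers `√(d+1) ≤ 2√d`, valid for `d ≥ 1`.
  have h5 : 1 ≤ ENNReal.ofReal (2 / √((d : ℝ) + 1)) * ENNReal.ofReal √d := by
    rw [← ENNReal.ofReal_mul (by positivity), ENNReal.one_le_ofReal, div_mul_eq_mul_div,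
      one_le_div (by positivity)]
    refine Real.sqrt_le_iff.2 ⟨by positivity, ?_⟩
    rw [mul_pow, Real.sq_sqrt (by positivity)]
    linarith
  calc a = 1 * a := (one_mul a).symm
    _ ≤ ENNReal.ofReal (2 / √((d : ℝ) + 1)) * ENNReal.ofReal √d * a := by gcongr
    _ ≤ _ := by rw [mul_assoc]; gcongr

theorem eLpNorm_sub_sqrt_mul_inner_le
    (h : stdGaussian (EuclideanSpace ℝ (Fin d)) =
      ((sphereUniform (EuclideanSpace ℝ (Fin d))).prod τ).map
        fun p => (p.2 : ℝ) • (p.1 : EuclideanSpace ℝ (Fin d)))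
    {w : EuclideanSpace ℝ (Fin d)} (hw : ‖w‖ ≤ 1) (hd : 1 ≤ d) :
    eLpNorm (fun q : Metric.sphere (0 : EuclideanSpace ℝ (Fin d)) 1 × Ioi (0 : ℝ) =>
        ((q.2 : ℝ) - √((d : ℝ) + 1)) * inner ℝ w (q.1 : _)) 2
        ((sphereUniform (EuclideanSpace ℝ (Fin d))).prod τ) ≤
      ENNReal.ofReal (√(Var[fun x => x ^ 2; gaussianReal 0 1]) + 1) *
        (ENNReal.ofReal (2 / √((d : ℝ) + 1)) * eLpNorm id 2 (gaussianReal 0 1)) := by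
  rw [eLpNorm_mul_prod (f := fun Ω : Metric.sphere (0 : EuclideanSpace ℝ (Fin d)) 1 =>
      inner ℝ w (Ω : _)) (g := fun r : Ioi (0 : ℝ) => (r : ℝ) - √((d : ℝ) + 1))
      (by fun_prop) (by fun_prop) (by simp) (by simp),
    ← eLpNorm_comp_norm_of_polar h (g := fun r => r - √((d : ℝ) + 1)) (by fun_prop)]
  exact mul_le_mul' (eLpNorm_norm_sub_sqrt_stdGaussian_le d)
    (eLpNorm_inner_sphereUniform_le h hw hd le_rfl (by simp))

end Radial

end SphericalModel

/-! ### Coupling of the two ensembles. -/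

namespace SphericalModel

open ProbabilityTheory Set

theorem map_prod_stdGaussian (E : Type*) [NormedAddCommGroup E]
    [InnerProductSpace ℝ E] [FiniteDimensional ℝ E] [MeasurableSpace E] [BorelSpace E] :
    ((gaussianReal 0 1).prod (stdGaussian E)).map (WithLp.toLp 2) =
      stdGaussian (WithLp 2 (ℝ × E)) := by
  have : IsProbabilityMeasure (((gaussianReal 0 1).prod (stdGaussian E)).map (WithLp.toLp 2)) :=
    Measure.isProbabilityMeasure_map (by fun_prop)
  apply Measure.ext_of_charFun
  ext t
  rw [charFun_prod, charFun_stdGaussian, charFun_stdGaussian, charFun_gaussianReal,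
    ← Complex.exp_add]
  congr 1
  rw [← Complex.ofReal_pow ‖t‖, WithLp.prod_norm_sq_eq_of_L2]
  simp
  ring

/-- The sample space of the coupling: a Gaussian magnetization fluctuation, a direction and a
radius. -/
abbrev CouplingSpace (N : ℕ) : Type :=
  ℝ × Metric.sphere (0 : EuclideanSpace ℝ (Fin (N - 1))) 1 × Ioi (0 : ℝ)

/-- The microcanonical and the grand canonical ensemble have a coupling whose coordinates are
`O(N^{-1/2})`-close in mean square and have uniformly bounded moments. -/
theorem exists_coupling (m ρ : ℝ) (hv : 0 < ρ - m ^ 2) :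
    ∃ (C : ENNReal) (B : ENNReal → ENNReal), C ≠ ⊤ ∧ (∀ p, p ≠ ⊤ → B p ≠ ⊤) ∧
      ∀ N : ℕ, 2 ≤ N → ∀ U : Config N ≃ₗᵢ[ℝ] Split N, IsMagnetizationFrame U →
      ∃ (P : Measure (CouplingSpace N)) (X Y : CouplingSpace N → Config N),
        IsProbabilityMeasure P ∧ Measurable X ∧ Measurable Y ∧
        P.map X = microcanonical U m ρ ∧
        P.map Y = grandCanonical N (-(m / (ρ - m ^ 2))) (1 / (2 * (ρ - m ^ 2))) ∧
        (∀ x, eLpNorm (fun ω => X ω x - Y ω x) 2 P ≤ C * ENNReal.ofReal (1 / √(N : ℝ))) ∧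
        (∀ x, ∀ p, 2 ≤ p → p ≠ ⊤ →
          eLpNorm (fun ω => X ω x) p P ≤ B p ∧ eLpNorm (fun ω => Y ω x) p P ≤ B p) := by
  set v := ρ - m ^ 2 with hvdef
  set A : ENNReal → ENNReal := fun p => eLpNorm id p (gaussianReal 0 1) with hA
  have hAtop : ∀ p, p ≠ ⊤ → A p ≠ ⊤ := fun p hp => (memLp_id_gaussianReal' p hp).2.ne
  set K : ℝ := √(Var[fun x => x ^ 2; gaussianReal 0 1]) + 1
  -- In the first constant, `A 2` comes from the magnetization fluctuation and `K · 2 · A 2` from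
  -- the radial one.
  refine ⟨ENNReal.ofReal √v * (A 2 + ENNReal.ofReal K * (2 * A 2)),
    fun p => ENNReal.ofReal |m| + ENNReal.ofReal √v * (2 * A p), ?_, ?_, ?_⟩
  · have := hAtop 2 (by simp)
    finiteness
  · intro p hp
    have := hAtop p hp
    finiteness
  intro N hN U hU
  have hN0 : (0 : ℝ) < N := by positivity
  have hsN : (0 : ℝ) < √(N : ℝ) := Real.sqrt_pos.2 hN0
  have hN1 : (1 : ℝ) ≤ √(N : ℝ) := Real.one_le_sqrt.2 (by exact_mod_cast (by omega : 1 ≤ N))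
  have hd : 1 ≤ N - 1 := by omega
  have hdN : ((N - 1 : ℕ) : ℝ) + 1 = N := by
    rw [Nat.cast_sub (by omega)]; simp
  have : Nonempty (Fin (N - 1)) := ⟨⟨0, by omega⟩⟩
  obtain ⟨hσ, τ, hτ, hpolar⟩ :=
    exists_stdGaussian_eq_map_sphereUniform_prod (EuclideanSpace ℝ (Fin (N - 1)))
  set σ := sphereUniform (EuclideanSpace ℝ (Fin (N - 1)))
  set P : Measure (CouplingSpace N) := (gaussianReal 0 1).prod (σ.prod τ) with hP
  set w : Fin N → EuclideanSpace ℝ (Fin (N - 1)) := fun x => (U (EuclideanSpace.single x 1)).snd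
  have hw : ∀ x, ‖w x‖ ≤ 1 := norm_snd_apply_single_le U
  -- Both fields use the same direction `ω.2.1`; `Y` replaces the fixed magnetization and radius by
  -- Gaussian ones.
  set X : CouplingSpace N → Config N := fun ω =>
    U.symm (WithLp.toLp 2 (m * √(N : ℝ), √((N : ℝ) * v) • (ω.2.1 : EuclideanSpace ℝ (Fin (N - 1)))))
  set Y : CouplingSpace N → Config N := fun ω =>
    WithLp.toLp 2 (fun _ => m) + √v • U.symm (WithLp.toLp 2
      (ω.1, (ω.2.2 : ℝ) • (ω.2.1 : EuclideanSpace ℝ (Fin (N - 1)))))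
  have hXx : ∀ ω x, X ω x = m + √v * (√(N : ℝ) * inner ℝ (w x) (ω.2.1 : EuclideanSpace ℝ (Fin (N - 1)))) := by
    intro ω x
    simp only [X]
    rw [hU.symm_apply, inner_smul_right, Real.sqrt_mul hN0.le]
    simp only [w]
    field_simp
  have hYx : ∀ ω x, Y ω x = m + √v * (1 / √(N : ℝ) * ω.1 + ω.2.2 * inner ℝ (w x) (ω.2.1 : EuclideanSpace ℝ (Fin (N - 1)))) := by
    intro ω x
    simp only [Y, PiLp.add_apply, PiLp.smul_apply, smul_eq_mul]
    rw [hU.symm_apply, inner_smul_right]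
  have hXm : Measurable X := by fun_prop
  have hYm : Measurable Y := by fun_prop
  -- moments of the ingredients
  have hz : ∀ p, eLpNorm (fun ω : CouplingSpace N => 1 / √(N : ℝ) * ω.1) p P =
      ENNReal.ofReal (1 / √(N : ℝ)) * A p := by
    intro p
    have h1 := eLpNorm_const_smul (1 / √(N : ℝ)) (fun ω : CouplingSpace N => ω.1) p P
    rw [← Real.enorm_of_nonneg (by positivity)]
    refine h1.trans ?_
    congr 1
    exact eLpNorm_comp_measurePreserving (g := (id : ℝ → ℝ)) (by fun_prop) measurePreserving_fst
  have hsnd : MeasurePreserving (Prod.snd : CouplingSpace N → _) P (σ.prod τ) :=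
    measurePreserving_snd
  have hΩ : MeasurePreserving (fun ω : CouplingSpace N => ω.2.1) P σ :=
    measurePreserving_fst.comp hsnd
  have hin : ∀ x p, 2 ≤ p → p ≠ ⊤ →
      eLpNorm (fun ω : CouplingSpace N => √(N : ℝ) * inner ℝ (w x) (ω.2.1 : EuclideanSpace ℝ (Fin (N - 1)))) p P ≤
        2 * A p := by
    intro x p hp2 hp
    have h1 := eLpNorm_const_smul (√(N : ℝ))
      (fun ω : CouplingSpace N => inner ℝ (w x) (ω.2.1 : EuclideanSpace ℝ (Fin (N - 1)))) p P
    have h2 := eLpNorm_comp_measurePreserving (p := p) (g := fun Ω : Metric.sphere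
      (0 : EuclideanSpace ℝ (Fin (N - 1))) 1 => inner ℝ (w x) (Ω : EuclideanSpace ℝ (Fin (N - 1)))) (by fun_prop) hΩ
    have h3 := eLpNorm_inner_sphereUniform_le hpolar (hw x) hd hp2 hp
    rw [hdN, ← h2] at h3
    refine h1.trans_le ((mul_le_mul' le_rfl h3).trans ?_)
    rw [← mul_assoc, Real.enorm_of_nonneg hsN.le, ← ENNReal.ofReal_mul hsN.le,
      mul_div_cancel₀ _ hsN.ne']
    simp [A]
  have hrin : ∀ x p, eLpNorm (fun ω : CouplingSpace N =>
      (ω.2.2 : ℝ) * inner ℝ (w x) (ω.2.1 : EuclideanSpace ℝ (Fin (N - 1)))) p P ≤ A p := by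
    intro x p
    have h1 := eLpNorm_inner_stdGaussian (w x) p
    rw [hpolar, eLpNorm_map_measure (by fun_prop) (by fun_prop)] at h1
    have h2 := eLpNorm_comp_measurePreserving (p := p) (g := (fun y => inner ℝ (w x) y) ∘
      fun q : Metric.sphere (0 : EuclideanSpace ℝ (Fin (N - 1))) 1 × Ioi (0 : ℝ) =>
        (q.2 : ℝ) • (q.1 : EuclideanSpace ℝ (Fin (N - 1)))) (by fun_prop) hsnd
    rw [h1] at h2
    calc _ = ‖w x‖ₑ * A p := by
          rw [← h2]; congr 1 with ω; simp [inner_smul_right]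
      _ ≤ 1 * A p := by
          gcongr
          rw [← ofReal_norm, ENNReal.ofReal_le_one]
          exact hw x
      _ = _ := one_mul _
  have hdiff : ∀ x, eLpNorm (fun ω : CouplingSpace N =>
      ((ω.2.2 : ℝ) - √(N : ℝ)) * inner ℝ (w x) (ω.2.1 : EuclideanSpace ℝ (Fin (N - 1)))) 2 P ≤
        ENNReal.ofReal K * (ENNReal.ofReal (2 / √(N : ℝ)) * A 2) := by
    intro x
    have h1 := eLpNorm_sub_sqrt_mul_inner_le hpolar (hw x) hd
    rw [hdN] at h1
    rwa [← eLpNorm_comp_measurePreserving (by fun_prop) hsnd] at h1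
  have haff : ∀ (p : ENNReal) (g : CouplingSpace N → ℝ) (b : ENNReal), 1 ≤ p → Measurable g →
      eLpNorm g p P ≤ b →
      eLpNorm (fun ω => m + √v * g ω) p P ≤ ENNReal.ofReal |m| + ENNReal.ofReal √v * b := by
    intro p g b hp hg hgb
    refine (eLpNorm_add_le (f := fun _ => m) (g := fun ω => √v * g ω) (by fun_prop)
      (by fun_prop) hp).trans (add_le_add ?_ ?_)
    · rw [eLpNorm_const _ (by positivity) (NeZero.ne _)]
      simp [Real.enorm_eq_ofReal_abs]
    · have := eLpNorm_const_smul (√v) g p P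
      refine this.trans_le ?_
      rw [Real.enorm_of_nonneg (by positivity)]
      gcongr
  refine ⟨P, X, Y, inferInstance, hXm, hYm, ?_, ?_, ?_, ?_⟩
  · change _ = σ.map _
    rw [← hΩ.map_eq, Measure.map_map (by fun_prop) (by fun_prop)]
    rfl
  -- Rotation invariance replaces the Gaussian on configurations by the image under `U⁻¹` of the one
  -- on the split space, which factors into `z` and `rΩ`.
  · rw [grandCanonical_eq_map_stdGaussian N m hv, ← stdGaussian_map U.symm, ← map_prod_stdGaussian,
      hpolar]
    have h1 : (gaussianReal 0 1).prod ((σ.prod τ).map fun p => (p.2 : ℝ) •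
        (p.1 : EuclideanSpace ℝ (Fin (N - 1)))) = P.map (fun ω => (ω.1, (ω.2.2 : ℝ) •
        (ω.2.1 : EuclideanSpace ℝ (Fin (N - 1))))) := by
      conv_lhs => rw [← Measure.map_id (μ := gaussianReal 0 1)]
      rw [Measure.map_prod_map _ _ (by fun_prop) (by fun_prop)]
      rfl
    rw [h1, Measure.map_map (by fun_prop) (by fun_prop), Measure.map_map (by fun_prop) (by fun_prop),
      Measure.map_map (by fun_prop) (by fun_prop)]
    rfl
  · intro x
    have e : (fun ω => X ω x - Y ω x) = (-√v) • ((fun ω : CouplingSpace N => 1 / √(N : ℝ) * ω.1) +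
        fun ω : CouplingSpace N => ((ω.2.2 : ℝ) - √(N : ℝ)) * inner ℝ (w x) (ω.2.1 : EuclideanSpace ℝ (Fin (N - 1)))) := by
      ext ω
      rw [hXx, hYx]
      simp only [Pi.smul_apply, Pi.add_apply, smul_eq_mul]
      ring
    rw [e, eLpNorm_const_smul, enorm_neg, Real.enorm_of_nonneg (by positivity), mul_assoc]
    refine mul_le_mul' le_rfl ((eLpNorm_add_le (by fun_prop) (by fun_prop) (by simp)).trans ?_)
    rw [hz, add_mul, mul_comm (A 2)]
    refine add_le_add le_rfl ((hdiff x).trans (le_of_eq ?_))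
    rw [div_eq_mul_one_div, ENNReal.ofReal_mul (by norm_num)]
    simp only [ENNReal.ofReal_ofNat]
    ring
  · intro x p hp2 hp
    have hp1 : 1 ≤ p := le_trans (by norm_num) hp2
    simp only [hXx, hYx]
    refine ⟨haff p _ _ hp1 (by fun_prop) (hin x p hp2 hp), haff p _ _ hp1 (by fun_prop) ?_⟩
    refine (eLpNorm_add_le (f := fun ω : CouplingSpace N => 1 / √(N : ℝ) * ω.1)
      (g := fun ω : CouplingSpace N => (ω.2.2 : ℝ) * inner ℝ (w x) (ω.2.1 : EuclideanSpace ℝ (Fin (N - 1))))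
      (by fun_prop) (by fun_prop) hp1).trans ?_
    rw [hz, two_mul]
    refine add_le_add ?_ (hrin x p)
    refine mul_le_of_le_one_left' ?_
    rw [ENNReal.ofReal_le_one, div_le_one hsN]
    exact hN1

end SphericalModel

/-! ### Observables with polynomially growing difference quotients. -/

namespace SphericalModel

/-- A real function whose difference quotients grow at most polynomially. -/
def HasPolynomialLipschitzBound {F : Type*} [NormedAddCommGroup F] (f : F → ℝ) : Prop :=
  ∃ (L : ℝ) (q : ℕ), 0 ≤ L ∧ ∀ a b, |f a - f b| ≤ L * (1 + ‖a‖ + ‖b‖) ^ q * ‖a - b‖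

namespace HasPolynomialLipschitzBound

variable {F : Type*} [NormedAddCommGroup F] {f g : F → ℝ}

theorem of_lipschitzWith {K : NNReal} (hf : LipschitzWith K f) : HasPolynomialLipschitzBound f :=
  ⟨K, 0, K.2, fun a b => by simpa [Real.dist_eq, dist_eq_norm] using hf.dist_le_mul a b⟩

theorem one : HasPolynomialLipschitzBound (fun _ : F => (1 : ℝ)) :=
  ⟨0, 0, le_rfl, by simp⟩

/-- Comparison with the value at `0`. The superfluous `‖b‖` lets one weight control `f a` and `f b`
alike. -/
theorem abs_le {L : ℝ} {q : ℕ} (hL : 0 ≤ L)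
    (hf : ∀ a b, |f a - f b| ≤ L * (1 + ‖a‖ + ‖b‖) ^ q * ‖a - b‖) (a b : F) :
    |f a| ≤ (|f 0| + L) * (1 + ‖a‖ + ‖b‖) ^ (q + 1) := by
  have ha := norm_nonneg a
  have hb := norm_nonneg b
  have h1 : |f a| ≤ |f 0| + |f a - f 0| := by
    simpa using abs_add_le (f 0) (f a - f 0)
  have h2 := hf a 0
  simp only [norm_zero, add_zero, sub_zero] at h2
  have h3 : |f 0| ≤ |f 0| * (1 + ‖a‖ + ‖b‖) ^ (q + 1) :=
    le_mul_of_one_le_right (abs_nonneg _) (one_le_pow₀ (by linarith))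
  have h4 : L * (1 + ‖a‖) ^ q * ‖a‖ ≤ L * (1 + ‖a‖ + ‖b‖) ^ (q + 1) := by
    rw [pow_succ, ← mul_assoc]
    have h5 : 1 + ‖a‖ ≤ 1 + ‖a‖ + ‖b‖ := by linarith
    have h6 : ‖a‖ ≤ 1 + ‖a‖ + ‖b‖ := by linarith
    exact mul_le_mul (mul_le_mul_of_nonneg_left (pow_le_pow_left₀ (by positivity) h5 q) hL) h6 ha
      (by positivity)
  linarith

theorem mul (hf : HasPolynomialLipschitzBound f) (hg : HasPolynomialLipschitzBound g) :
    HasPolynomialLipschitzBound (fun x => f x * g x) := by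
  obtain ⟨L, q, hL, hf⟩ := hf
  obtain ⟨M, r, hM, hg⟩ := hg
  refine ⟨(|f 0| + L) * M + (|g 0| + M) * L, q + r + 1, by positivity, fun a b => ?_⟩
  have hf' := abs_le hL hf a b
  have hg' := abs_le hM hg b a
  rw [add_right_comm] at hg'
  have hf1 := hf a b
  have hg1 := hg a b
  set T := 1 + ‖a‖ + ‖b‖
  have hT : 0 ≤ T := by positivity
  have e : f a * g a - f b * g b = f a * (g a - g b) + g b * (f a - f b) := by ring
  rw [e]
  refine (abs_add_le _ _).trans ?_
  rw [abs_mul, abs_mul]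
  calc |f a| * |g a - g b| + |g b| * |f a - f b|
      ≤ (|f 0| + L) * T ^ (q + 1) * (M * T ^ r * ‖a - b‖) +
        (|g 0| + M) * T ^ (r + 1) * (L * T ^ q * ‖a - b‖) := by gcongr
    _ = _ := by ring

theorem pow (hf : HasPolynomialLipschitzBound f) (k : ℕ) :
    HasPolynomialLipschitzBound (fun x => f x ^ k) := by
  induction k with
  | zero => simpa using one
  | succ k ih => simpa only [pow_succ] using ih.mul hf

theorem prod {ι : Type*} {f : ι → F → ℝ} (s : Finset ι)
    (hf : ∀ i, HasPolynomialLipschitzBound (f i)) :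
    HasPolynomialLipschitzBound (fun x => ∏ i ∈ s, f i x) := by
  classical
  induction s using Finset.induction_on with
  | empty => simpa using one
  | insert i s hi ih => simpa only [Finset.prod_insert hi] using (hf i).mul ih

theorem continuous (hf : HasPolynomialLipschitzBound f) : Continuous f := by
  obtain ⟨L, q, hL, hf⟩ := hf
  refine continuous_iff_continuousAt.2 fun b => ?_
  rw [ContinuousAt, tendsto_iff_norm_sub_tendsto_zero]
  have : Filter.Tendsto (fun a => L * (1 + ‖a‖ + ‖b‖) ^ q * ‖a - b‖) (nhds b)
      (nhds (L * (1 + ‖b‖ + ‖b‖) ^ q * ‖b - b‖)) :=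
    Continuous.tendsto (by fun_prop) b
  rw [sub_self, norm_zero, mul_zero] at this
  exact squeeze_zero (fun _ => norm_nonneg _) (fun a => hf a b) this

end HasPolynomialLipschitzBound

theorem hasPolynomialLipschitzBound_of_observable {n : ℕ} {f : EuclideanSpace ℝ (Fin n) → ℝ}
    (hf : IsBoundedLipschitz f ∨ IsMoment f) : HasPolynomialLipschitzBound f := by
  obtain ⟨-, hf⟩ | ⟨k, hk⟩ := hf
  · exact .of_lipschitzWith hf
  · obtain rfl : f = fun y => ∏ i, y i ^ k i := funext hk
    refine .prod _ fun i => .pow (.of_lipschitzWith (K := 1) ?_) _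
    refine LipschitzWith.of_dist_le_mul fun a b => ?_
    simpa [dist_eq_norm] using PiLp.norm_apply_le (a - b) i

/-- Random vectors that are close in mean square and have bounded moments have close expectations
of functions with polynomially growing difference quotients. -/
theorem abs_integral_comp_sub_le {Ω F : Type*} {mΩ : MeasurableSpace Ω} {P : Measure Ω}
    [IsProbabilityMeasure P] [NormedAddCommGroup F] [MeasurableSpace F] [BorelSpace F]
    [SecondCountableTopology F] {f : F → ℝ} (hfc : Continuous f) {L : ℝ} {q : ℕ} (hL : 0 ≤ L)
    (hf : ∀ a b, |f a - f b| ≤ L * (1 + ‖a‖ + ‖b‖) ^ q * ‖a - b‖)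
    {V W : Ω → F} (hV : Measurable V) (hW : Measurable W) {b δ : ENNReal} (hb : b ≠ ⊤) (hδ : δ ≠ ⊤)
    (hVb : eLpNorm V (2 * ENNReal.ofReal ((q + 1 : ℕ) : ℝ)) P ≤ b)
    (hWb : eLpNorm W (2 * ENNReal.ofReal ((q + 1 : ℕ) : ℝ)) P ≤ b)
    (hVW : eLpNorm (fun ω => V ω - W ω) 2 P ≤ δ) :
    Integrable (fun ω => f (V ω)) P ∧ Integrable (fun ω => f (W ω)) P ∧
      |∫ ω, f (V ω) ∂P - ∫ ω, f (W ω) ∂P| ≤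
        (ENNReal.ofReal L * ((1 + b + b) ^ (q + 1) * δ)).toReal := by
  set T : Ω → ℝ := fun ω => 1 + ‖V ω‖ + ‖W ω‖
  have hT1 : ∀ ω, 1 ≤ T ω := fun ω => by
    simp only [T]; linarith [norm_nonneg (V ω), norm_nonneg (W ω)]
  have hTm : Measurable T := by fun_prop
  have hp : 1 ≤ 2 * ENNReal.ofReal ((q + 1 : ℕ) : ℝ) := by
    rw [ENNReal.ofReal_natCast]
    exact_mod_cast (by omega : 1 ≤ 2 * (q + 1))
  have hTp : eLpNorm T (2 * ENNReal.ofReal ((q + 1 : ℕ) : ℝ)) P ≤ 1 + b + b := by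
    refine (eLpNorm_add_le (f := fun ω => 1 + ‖V ω‖) (g := fun ω => ‖W ω‖) (by fun_prop)
      (by fun_prop) hp).trans (add_le_add ?_ (by rwa [eLpNorm_norm]))
    refine (eLpNorm_add_le (f := fun _ => (1 : ℝ)) (g := fun ω => ‖V ω‖) (by fun_prop)
      (by fun_prop) hp).trans (add_le_add ?_ (by rwa [eLpNorm_norm]))
    rw [eLpNorm_const _ (by positivity) (NeZero.ne _)]
    simp
  -- The moment order `2(q+1)` is chosen so that `T^(q+1)` lies in `L²`; this dominates `f` itself
  -- as well as its difference quotients.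
  have hTq : eLpNorm (fun ω => T ω ^ (q + 1)) 2 P ≤ (1 + b + b) ^ (q + 1) := by
    have h := eLpNorm_norm_rpow (μ := P) (p := 2) T (q := ((q + 1 : ℕ) : ℝ)) (by positivity)
    simp only [Real.rpow_natCast, ENNReal.rpow_natCast] at h
    have e : (fun ω => T ω ^ (q + 1)) = fun ω => ‖T ω‖ ^ (q + 1) := by
      ext ω; rw [Real.norm_of_nonneg (zero_le_one.trans (hT1 ω))]
    rw [e, h]
    gcongr
  have hTL : MemLp (fun ω => T ω ^ (q + 1)) 2 P :=
    ⟨by fun_prop, hTq.trans_lt (by finiteness)⟩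
  have hTint : Integrable (fun ω => (|f 0| + L) * T ω ^ (q + 1)) P :=
    (hTL.integrable (by simp)).const_mul _
  have hfV : Integrable (fun ω => f (V ω)) P :=
    hTint.mono' (hfc.measurable.comp hV).aestronglyMeasurable
      (.of_forall fun ω => HasPolynomialLipschitzBound.abs_le hL hf (V ω) (W ω))
  have hfW : Integrable (fun ω => f (W ω)) P := by
    refine hTint.mono' (hfc.measurable.comp hW).aestronglyMeasurable (.of_forall fun ω => ?_)
    have := HasPolynomialLipschitzBound.abs_le hL hf (W ω) (V ω)
    rwa [add_right_comm] at this
  refine ⟨hfV, hfW, ?_⟩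
  -- Cauchy–Schwarz: only the factor `‖V - W‖` has to be small.
  have hHolder : eLpNorm (fun ω => T ω ^ (q + 1) * ‖V ω - W ω‖) 1 P ≤ (1 + b + b) ^ (q + 1) * δ := by
    have h := eLpNorm_smul_le_mul_eLpNorm (p := 2) (q := 2) (r := 1) (μ := P)
      (f := fun ω => ‖V ω - W ω‖) (φ := fun ω => T ω ^ (q + 1)) (by fun_prop) (by fun_prop)
    refine h.trans (mul_le_mul' hTq ?_)
    rwa [eLpNorm_norm]
  have hle : eLpNorm (fun ω => f (V ω) - f (W ω)) 1 P ≤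
      ENNReal.ofReal L * ((1 + b + b) ^ (q + 1) * δ) := by
    refine (eLpNorm_le_mul_eLpNorm_of_ae_le_mul
      (g := fun ω => T ω ^ (q + 1) * ‖V ω - W ω‖) (c := L) (.of_forall fun ω => ?_) 1).trans
      (mul_le_mul' le_rfl hHolder)
    have h0 : 0 ≤ T ω ^ (q + 1) * ‖V ω - W ω‖ :=
      mul_nonneg (pow_nonneg (zero_le_one.trans (hT1 ω)) _) (norm_nonneg _)
    rw [Real.norm_of_nonneg h0, ← mul_assoc]
    refine (hf _ _).trans ?_
    gcongr
    · exact hT1 ω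
    · exact Nat.le_succ q
  rw [← integral_sub hfV hfW, ← Real.norm_eq_abs]
  refine (norm_integral_le_integral_norm _).trans ?_
  rw [integral_norm_eq_lintegral_enorm (f := fun ω => f (V ω) - f (W ω))
      (hfV.sub hfW).aestronglyMeasurable,
    ← eLpNorm_one_eq_lintegral_enorm]
  exact ENNReal.toReal_mono (by finiteness) hle

/-- The triangle inequality over coordinates; the loss of a factor `n` is harmless because `n` stays
fixed. -/
theorem eLpNorm_euclideanSpace_le {Ω : Type*} {mΩ : MeasurableSpace Ω} {P : Measure Ω} {n : ℕ}
    {V : Ω → EuclideanSpace ℝ (Fin n)} (hV : Measurable V) {p : ENNReal} (hp : 1 ≤ p) {b : ENNReal}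
    (hb : ∀ j, eLpNorm (fun ω => V ω j) p P ≤ b) : eLpNorm V p P ≤ n * b := by
  have e : V = ∑ j, fun ω => EuclideanSpace.single j (V ω j) := by
    ext ω j
    simp [Finset.sum_apply, Pi.single_apply]
  calc eLpNorm V p P ≤ ∑ j, eLpNorm (fun ω => EuclideanSpace.single j (V ω j)) p P := by
        conv_lhs => rw [e]
        refine eLpNorm_sum_le (fun j _ => ?_) hp
        have : Measurable fun y : ℝ => (EuclideanSpace.single j y : EuclideanSpace ℝ (Fin n)) :=
          (LipschitzWith.of_dist_le_mul (K := 1) fun a b => by simp).continuous.measurable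
        exact (this.comp (by fun_prop)).aestronglyMeasurable
    _ = ∑ j, eLpNorm (fun ω => V ω j) p P :=
        Finset.sum_congr rfl fun j _ => eLpNorm_congr_norm_ae (.of_forall fun ω => by simp)
    _ ≤ ∑ _j : Fin n, b := Finset.sum_le_sum fun j _ => hb j
    _ = n * b := by simp

theorem measurable_proj {N n : ℕ} (I : Finset (Fin N)) (hI : I.card = n) :
    Measurable (proj I hI) := by
  unfold proj
  fun_prop

end SphericalModel

/-! ### Equivalence of ensembles. -/

theorem mainTheorem9 (ρ m μ η : ℝ) (hρ : 0 < ρ) (hm : m ∈ Set.Ioo (-√ρ) (√ρ))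
    (hμ : μ = -(m / (ρ - m ^ 2))) (hη : η = 1 / (2 * (ρ - m ^ 2)))
    (n : ℕ) (f : EuclideanSpace ℝ (Fin n) → ℝ)
    (hf : SphericalModel.IsBoundedLipschitz f ∨ SphericalModel.IsMoment f) :
    ∃ (C : ℝ) (N₀ : ℕ), ∀ N : ℕ, N₀ ≤ N →
      ∀ U : SphericalModel.Config N ≃ₗᵢ[ℝ] SphericalModel.Split N,
        SphericalModel.IsMagnetizationFrame U →
      ∀ (I : Finset (Fin N)) (hI : I.card = n),
        Integrable (fun φ => f (SphericalModel.proj I hI φ))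
          (SphericalModel.microcanonical U m ρ) ∧
        Integrable (fun φ => f (SphericalModel.proj I hI φ))
          (SphericalModel.grandCanonical N μ η) ∧
        |(∫ φ, f (SphericalModel.proj I hI φ) ∂SphericalModel.microcanonical U m ρ) -
            ∫ φ, f (SphericalModel.proj I hI φ) ∂SphericalModel.grandCanonical N μ η|
          ≤ C * (N : ℝ) ^ (-(1 / 2) : ℝ) := by
  have hv : 0 < ρ - m ^ 2 := sub_pos.2 (by
    rw [← Real.sq_sqrt hρ.le]; exact sq_lt_sq' hm.1 hm.2)
  subst hμ hη
  have hfb := SphericalModel.hasPolynomialLipschitzBound_of_observable hf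
  have hfc := hfb.continuous
  obtain ⟨L, q, hL, hfL⟩ := hfb
  obtain ⟨C, B, hC, hB, hcoup⟩ := SphericalModel.exists_coupling m ρ hv
  set p : ENNReal := 2 * ENNReal.ofReal ((q + 1 : ℕ) : ℝ) with hp
  have hptop : p ≠ ⊤ := by finiteness
  have hp2 : 2 ≤ p := by
    rw [hp, ENNReal.ofReal_natCast]
    exact_mod_cast (by omega : 2 ≤ 2 * (q + 1))
  have hp1 : 1 ≤ p := le_trans (by norm_num) hp2
  have hBp := hB p hptop
  set b := n * B p
  -- `C` and `B` were obtained before `N`, `U` and `I`, so the constant is uniform in them. `N ≥ 2`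
  -- makes the sphere nonempty.
  refine ⟨(ENNReal.ofReal L * ((1 + b + b) ^ (q + 1) * (n * C))).toReal, 2,
    fun N hN U hU I hI => ?_⟩
  obtain ⟨P, X, Y, hP, hX, hY, hXP, hYP, hdiff, hmom⟩ := hcoup N hN U hU
  have hproj := SphericalModel.measurable_proj I hI
  have hfp : Measurable fun φ => f (SphericalModel.proj I hI φ) := hfc.measurable.comp hproj
  have hVX := hproj.comp hX
  have hVY := hproj.comp hY
  obtain ⟨h1, h2, h3⟩ := SphericalModel.abs_integral_comp_sub_le (P := P) hfc hL hfL
    hVX hVY (b := b)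
    (δ := n * (C * ENNReal.ofReal (1 / √(N : ℝ)))) (by finiteness) (by finiteness)
    (SphericalModel.eLpNorm_euclideanSpace_le hVX hp1 fun j => (hmom _ p hp2 hptop).1)
    (SphericalModel.eLpNorm_euclideanSpace_le hVY hp1 fun j => (hmom _ p hp2 hptop).2)
    (SphericalModel.eLpNorm_euclideanSpace_le (hVX.sub hVY) (by norm_num) fun j => hdiff _)
  rw [← hXP, ← hYP, integrable_map_measure hfp.aestronglyMeasurable hX.aemeasurable,
    integrable_map_measure hfp.aestronglyMeasurable hY.aemeasurable,
    integral_map hX.aemeasurable hfp.aestronglyMeasurable,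
    integral_map hY.aemeasurable hfp.aestronglyMeasurable]
  refine ⟨h1, h2, h3.trans (le_of_eq ?_)⟩
  rw [← mul_assoc (n : ENNReal), ← mul_assoc (_ ^ _), ← mul_assoc, ENNReal.toReal_mul,
    ENNReal.toReal_ofReal (by positivity), Real.rpow_neg (by positivity), ← Real.sqrt_eq_rpow,
    one_div]
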